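/- For a connected simple graph $G$ with vertices $v_1,\dots,v_n$ and graph distance $d$, let $RD(G)$ be the $n\times n$ matrix with entries $1/d(v_i,v_j)$ for $i\neq j$ and zero diagonal, let $RT(G)$ be the diagonal matrix whose $i$-th diagonal entry is $\sum_{j\neq i} 1/d(v_i,v_j)$, and for real $\alpha$ put $RD_\alpha(G)=\alpha\,RT(G)+(1-\alpha)\,RD(G)$. Let $\rho(RD_\alpha(G))$ denote the largest eigenvalue of this real symmetric matrix. Let $T_{n,\chi}$ be the Turán graph, i.e. the complete $\chi$-partite graph on $n$ vertices each of whose parts has $\lfloor n/\chi\rfloor$ or $\lceil n/\chi\rceil$ vertices. **Theorem 4.4.** Let $n\ge 2$ and $2\le\chi\le n$ be integers and let $0\le\alpha\le \frac{7}{16}$. Then $T_{n,\chi}$ is, up to isomorphism, the unique graph with maximal $\rho(RD_\alpha(G))$ among all connected simple graphs $G$ of order $n$ with chromatic number $\chi$. That is, $T_{n,\chi}$ is connected with chromatic number $\chi$, and every connected simple graph $G$ of order $n$ with chromatic number $\chi$ satisfies $\rho(RD_\alpha(G))\le\rho(RD_\alpha(T_{n,\chi}))$, with equality if and only if $G\cong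 T_{n,\chi}$. -/

import Mathlib

namespace SimpleGraph

variable {V : Type*} [Fintype V] [DecidableEq V]

/-- The reciprocal distance (Harary) matrix `RD(G)`: the entry at `(u, v)` is `1 / d(u, v)` for
`u ≠ v`, and the diagonal is zero. -/
noncomputable def recipDistMatrix (G : SimpleGraph V) : Matrix V V ℝ :=
  Matrix.of fun u v => if u = v then 0 else 1 / (G.dist u v : ℝ)

/-- The reciprocal transmission of `u`: the sum of `1 / d(u, v)` over all vertices `v ≠ u`. -/
noncomputable def recipTransmission (G : SimpleGraph V) (u : V) : ℝ :=
  ∑ v ∈ Finset.univ.erase u, 1 / (G.dist u v : ℝ)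

/-- The matrix `RD_α(G) = α RT(G) + (1 - α) RD(G)`, where `RT(G)` is the diagonal matrix of the
reciprocal transmissions. -/
noncomputable def RDα (G : SimpleGraph V) (α : ℝ) : Matrix V V ℝ :=
  α • Matrix.diagonal G.recipTransmission + (1 - α) • G.recipDistMatrix

/-- The spectral radius `ρ(RD_α(G))`, that is, the largest eigenvalue of the real symmetric matrix
`RD_α(G)`. -/
noncomputable def rhoRDα (G : SimpleGraph V) (α : ℝ) : ℝ :=
  sSup (spectrum ℝ (G.RDα α))

theorem RDα_isHermitian (G : SimpleGraph V) (α : ℝ) : (G.RDα α).IsHermitian := by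
  ext u v
  by_cases h : u = v
  · subst h; simp
  · simp [RDα, recipDistMatrix, Matrix.diagonal, h, Ne.symm h, G.dist_comm]

/-- The supremum in the definition of `rhoRDα` is attained: it is the largest eigenvalue. -/
theorem isGreatest_rhoRDα [Nonempty V] (G : SimpleGraph V) (α : ℝ) :
    IsGreatest (spectrum ℝ (G.RDα α)) (G.rhoRDα α) := by
  have h := (G.RDα_isHermitian α).spectrum_real_eq_range_eigenvalues
  have hf : (spectrum ℝ (G.RDα α)).Finite := by rw [h]; exact Set.finite_range _
  have hn : (spectrum ℝ (G.RDα α)).Nonempty := by rw [h]; exact Set.range_nonempty _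
  exact ⟨hn.csSup_mem hf, fun _ hx => le_csSup hf.bddAbove hx⟩

end SimpleGraph

/-! Colour `G` with `χ` colours and test `RDα` on the positive vector `y v = 1 / (s + size of the
class of v)`. Distances in `G` are at least those of the complete multipartite model: 1 between
classes, 2 inside one. The model sends `y` to `l • y` plus the constant `(1 - α) * ∑ y - 1 / 2`,
with `l = α n + (s - 1) / 2` (`sum_multipartiteRecipDist`). Choose `s` so that the constant vanishes
for the Turán colouring; then `l` is the Turán spectral radius. As `x / (s + x)` is concave,
balanced classes maximise `∑ y`, so for `G` the constant is at most 0 and `RDα y ≤ l y`, whence `ρ ≤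
l`. Equality makes all these inequalities tight. -/

open Finset Matrix

/-! ### Comparing eigenvalues of nonnegative matrices through a positive test vector. -/

namespace Matrix

variable {V : Type*} [Fintype V]

theorem mem_spectrum_iff_exists_mulVec_eq_smul [DecidableEq V] {A : Matrix V V ℝ} {μ : ℝ} :
    μ ∈ spectrum ℝ A ↔ ∃ z : V → ℝ, z ≠ 0 ∧ A *ᵥ z = μ • z := by
  rw [spectrum.mem_iff, Matrix.isUnit_iff_isUnit_det, isUnit_iff_ne_zero, not_not,
    ← Matrix.exists_mulVec_eq_zero_iff]
  refine exists_congr fun z => and_congr_right fun _ => ?_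
  rw [Matrix.sub_mulVec, sub_eq_zero, Matrix.algebraMap_eq_diagonal, eq_comm]
  have : (diagonal (algebraMap ℝ (V → ℝ) μ)) *ᵥ z = μ • z := by
    ext i; simp [Matrix.mulVec_diagonal]
  rw [this]

/-- For an eigenvector `z` and a positive vector `y`, there are `c > 0` and a vertex `i` with
`|z| ≤ c y` and equality at `i`. -/
theorem exists_abs_le_mul {y z : V → ℝ} (hy : ∀ i, 0 < y i) (hz : z ≠ 0) :
    ∃ c : ℝ, 0 < c ∧ (∀ j, |z j| ≤ c * y j) ∧ ∃ i, |z i| = c * y i := by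
  obtain ⟨k, hk⟩ := Function.ne_iff.mp hz
  have : Nonempty V := ⟨k⟩
  obtain ⟨i, hi⟩ := Finite.exists_max fun j => |z j| / y j
  refine ⟨|z i| / y i, ?_, fun j => (div_le_iff₀ (hy j)).mp (hi j), i, ?_⟩
  · exact lt_of_lt_of_le (div_pos (abs_pos.mpr hk) (hy k)) (hi k)
  · rw [div_mul_cancel₀ _ (hy i).ne']

theorem abs_mul_le_sum_of_mulVec_eq_smul {A : Matrix V V ℝ} (hA : ∀ i j, 0 ≤ A i j) {μ : ℝ}
    {z : V → ℝ} (h : A *ᵥ z = μ • z) (i : V) : μ * |z i| ≤ ∑ j, A i j * |z j| := by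
  calc μ * |z i| ≤ |μ| * |z i| := mul_le_mul_of_nonneg_right (le_abs_self μ) (abs_nonneg _)
    _ = |∑ j, A i j * z j| := by
        rw [← abs_mul]
        congr 1
        exact (congrFun h i).symm
    _ ≤ ∑ j, |A i j * z j| := abs_sum_le_sum_abs _ _
    _ = ∑ j, A i j * |z j| :=
        sum_congr rfl fun j _ => by rw [abs_mul, abs_of_nonneg (hA i j)]

/-- A nonnegative matrix with a positive vector `y` satisfying `A y ≤ l y` has all its real
eigenvalues at most `l`. -/
theorem le_of_mem_spectrum_of_mulVec_le [DecidableEq V] {A : Matrix V V ℝ}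
    (hA : ∀ i j, 0 ≤ A i j) {l : ℝ} {y : V → ℝ} (hy : ∀ i, 0 < y i) (hle : ∀ i, (A *ᵥ y) i ≤ l * y i) {μ : ℝ}
    (hμ : μ ∈ spectrum ℝ A) : μ ≤ l := by
  obtain ⟨z, hz, h⟩ := mem_spectrum_iff_exists_mulVec_eq_smul.mp hμ
  -- Scale `y` until it touches `|z|` from above; the eigenvalue bound is read off at the contact
  -- point `i`.
  obtain ⟨c, hc, hzy, i, hi⟩ := exists_abs_le_mul hy hz
  have h1 := abs_mul_le_sum_of_mulVec_eq_smul hA h i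
  have h2 : ∑ j, A i j * |z j| ≤ c * (A *ᵥ y) i := by
    rw [Matrix.mulVec, dotProduct, mul_sum]
    exact sum_le_sum fun j _ => by nlinarith [mul_le_mul_of_nonneg_left (hzy j) (hA i j)]
  have h3 := mul_le_mul_of_nonneg_left (hle i) hc.le
  rw [hi] at h1
  exact le_of_mul_le_mul_right (by linarith) (mul_pos hc (hy i))

/-- If moreover the off-diagonal entries of `A` are positive and `l` is itself an eigenvalue, then
`y` is an eigenvector. -/
theorem mulVec_eq_of_mem_spectrum [DecidableEq V] {A : Matrix V V ℝ} (hA : ∀ i j, 0 ≤ A i j)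
    (hpos : ∀ i j, i ≠ j → 0 < A i j) {l : ℝ} {y : V → ℝ} (hy : ∀ i, 0 < y i)
    (hle : ∀ i, (A *ᵥ y) i ≤ l * y i) (hl : l ∈ spectrum ℝ A) (i : V) :
    (A *ᵥ y) i = l * y i := by
  obtain ⟨z, hz, h⟩ := mem_spectrum_iff_exists_mulVec_eq_smul.mp hl
  obtain ⟨c, hc, hzy, k, hk⟩ := exists_abs_le_mul hy hz
  have hterm : ∀ i j, A i j * |z j| ≤ c * (A i j * y j) := fun i j => by
    nlinarith [mul_le_mul_of_nonneg_left (hzy j) (hA i j)]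
  have hsum : ∀ i, c * (A *ᵥ y) i = ∑ j, c * (A i j * y j) := fun i => by
    rw [Matrix.mulVec, dotProduct, mul_sum]
  -- A strict gap at `j` would, through the positive entry `A k j`, make row `k` strict at the
  -- contact point `k`.
  have heq : ∀ j, |z j| = c * y j := by
    intro j
    by_cases hj : k = j
    · rw [← hj, hk]
    · by_contra hne
      have hlt : ∑ j, A k j * |z j| < ∑ j, c * (A k j * y j) :=
        sum_lt_sum (fun j _ => hterm k j) ⟨j, mem_univ j, by
          nlinarith [mul_lt_mul_of_pos_left (lt_of_le_of_ne (hzy j) hne) (hpos k j hj)]⟩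
      have h1 := abs_mul_le_sum_of_mulVec_eq_smul hA h k
      rw [hk] at h1
      have h3 := mul_le_mul_of_nonneg_left (hle k) hc.le
      rw [hsum] at h3
      linarith
  refine le_antisymm (hle i) (le_of_mul_le_mul_left ?_ hc)
  have h1 := abs_mul_le_sum_of_mulVec_eq_smul hA h i
  rw [heq i] at h1
  have h2 := sum_le_sum fun j (_ : j ∈ univ) => hterm i j
  rw [hsum]
  linarith

end Matrix

/-! ### Class sizes, concavity and balanced colourings. -/

section ColorClass

variable {V ι : Type*} [Fintype V] [DecidableEq ι]

/-- The number of vertices with colour `j`. -/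
def colorClassCard (c : V → ι) (j : ι) : ℕ := #{v | c v = j}

theorem sum_colorClassCard [Fintype ι] (c : V → ι) :
    ∑ j, colorClassCard c j = Fintype.card V := by
  simpa [colorClassCard] using
    (card_eq_sum_card_fiberwise (s := univ) (t := univ) (f := c) (fun _ _ => mem_univ _)).symm

theorem colorClassCard_pos (c : V → ι) (v : V) : 0 < colorClassCard c (c v) :=
  card_pos.mpr ⟨v, by simp⟩

theorem sum_inv_add_colorClassCard [Fintype ι] (c : V → ι) (s : ℝ) :
    ∑ v, 1 / (s + colorClassCard c (c v)) =
      ∑ j, (colorClassCard c j : ℝ) / (s + colorClassCard c j) := by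
  rw [← sum_fiberwise' univ c fun j => 1 / (s + colorClassCard c j)]
  refine sum_congr rfl fun j _ => ?_
  rw [sum_const, nsmul_eq_mul, mul_one_div]
  rfl

/-- Intermediate values on `[0, 2 |V|]`: the sum is at least 1 at the left end and at most 1/2 at
the right end. -/
theorem exists_pos_sum_inv_add_colorClassCard_eq [Nonempty V] (c : V → ι) {b : ℝ}
    (hb : 1 / 2 ≤ b) (hb1 : b < 1) :
    ∃ s : ℝ, 0 < s ∧ ∑ v, 1 / (s + colorClassCard c (c v)) = b := by
  have hpos : ∀ v, (0 : ℝ) < colorClassCard c (c v) := fun v => by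
    exact_mod_cast colorClassCard_pos c v
  have hcard : (0 : ℝ) < Fintype.card V := by exact_mod_cast Fintype.card_pos
  have hcont : ContinuousOn (fun s : ℝ => ∑ v, 1 / (s + colorClassCard c (c v)))
      (Set.Icc 0 (2 * Fintype.card V)) :=
    continuousOn_finsetSum _ fun v _ => continuousOn_const.div
      (continuousOn_id.add continuousOn_const) fun s hs => by
        have := hpos v
        have := hs.1
        change s + (colorClassCard c (c v) : ℝ) ≠ 0
        positivity
  have h0 : 1 ≤ ∑ v, 1 / ((0 : ℝ) + colorClassCard c (c v)) := by
    calc (1 : ℝ) = ∑ _v : V, 1 / (Fintype.card V : ℝ) := by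
          simp [hcard.ne']
      _ ≤ _ := sum_le_sum fun v _ => by
          rw [zero_add]
          exact one_div_le_one_div_of_le (hpos v) (by exact_mod_cast card_le_univ _)
  have h1 : ∑ v, 1 / (2 * (Fintype.card V : ℝ) + colorClassCard c (c v)) ≤ 1 / 2 := by
    calc _ ≤ ∑ _v : V, 1 / (2 * (Fintype.card V : ℝ)) := sum_le_sum fun v _ =>
          one_div_le_one_div_of_le (by positivity) (by linarith [hpos v])
      _ = 1 / 2 := by
          simp only [sum_const, card_univ, nsmul_eq_mul]
          field_simp
  obtain ⟨s, hs, hsb⟩ := intermediate_value_Icc' (by positivity) hcont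
    ⟨h1.trans hb, hb1.le.trans h0⟩
  refine ⟨s, lt_of_le_of_ne hs.1 ?_, hsb⟩
  rintro rfl
  dsimp only at hsb
  linarith

/-- The linear function is the chord of `x / (s + x)` through `q` and `q + 1`. Its excess has the
sign of `(k - q) * (k - q - 1)`, which is never negative at integers. -/
theorem chord_sub_div_add {s : ℝ} (hs : 0 < s) (k q : ℕ) :
    (q / (s + q) + (k - q) * (s / ((s + q) * (s + q + 1))) - k / (s + k) : ℝ) =
      s * ((k - q) * (k - q - 1)) / ((s + k) * (s + q) * (s + q + 1)) := by
  field_simp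
  ring

theorem cast_sub_mul_sub_one_nonneg (k q : ℕ) : (0 : ℝ) ≤ (k - q) * (k - q - 1) := by
  rcases le_or_gt k q with h | h
  · have : (k : ℝ) ≤ q := by exact_mod_cast h
    nlinarith
  · have : (q : ℝ) + 1 ≤ k := by exact_mod_cast h
    nlinarith

theorem div_add_le_chord {s : ℝ} (hs : 0 < s) (k q : ℕ) :
    (k / (s + k) : ℝ) ≤ q / (s + q) + (k - q) * (s / ((s + q) * (s + q + 1))) := by
  rw [← sub_nonneg, chord_sub_div_add hs]
  have := cast_sub_mul_sub_one_nonneg k q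
  positivity

theorem div_add_eq_chord_iff {s : ℝ} (hs : 0 < s) (k q : ℕ) :
    (k / (s + k) : ℝ) = q / (s + q) + (k - q) * (s / ((s + q) * (s + q + 1))) ↔
      k = q ∨ k = q + 1 := by
  rw [eq_comm, ← sub_eq_zero, chord_sub_div_add hs, div_eq_zero_iff,
    or_iff_left (by positivity), mul_eq_zero, or_iff_right hs.ne', mul_eq_zero,
    sub_eq_zero, sub_sub, sub_eq_zero]
  norm_cast

/-- All colour classes have `q` or `q + 1` vertices. -/
def IsBalancedColoring (c : V → ι) (q : ℕ) : Prop :=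
  ∀ j, colorClassCard c j = q ∨ colorClassCard c j = q + 1

variable [Fintype ι]

/-- The chord is affine, so its total depends on the colouring only through the numbers of vertices
and colours. -/
theorem sum_chord_colorClassCard (c : V → ι) (s : ℝ) (q : ℕ) :
    ∑ j, ((q : ℝ) / (s + q) + (colorClassCard c j - q) * (s / ((s + q) * (s + q + 1)))) =
      Fintype.card ι * (q / (s + q)) +
        (Fintype.card V - Fintype.card ι * q) * (s / ((s + q) * (s + q + 1))) := by
  rw [sum_add_distrib, ← sum_mul, sum_sub_distrib, ← sum_colorClassCard c]
  simp

theorem sum_inv_add_colorClassCard_le {W : Type*} [Fintype W] {c : V → ι} {t : W → ι} {q : ℕ}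
    (ht : IsBalancedColoring t q) (hcard : Fintype.card V = Fintype.card W) {s : ℝ} (hs : 0 < s) :
    ∑ v, 1 / (s + colorClassCard c (c v)) ≤ ∑ w, 1 / (s + colorClassCard t (t w)) := by
  rw [sum_inv_add_colorClassCard, sum_inv_add_colorClassCard,
    sum_congr rfl fun j _ => (div_add_eq_chord_iff hs (colorClassCard t j) q).mpr (ht j),
    sum_chord_colorClassCard, ← hcard, ← sum_chord_colorClassCard]
  exact sum_le_sum fun j _ => div_add_le_chord hs _ _

theorem isBalancedColoring_of_sum_eq {W : Type*} [Fintype W] {c : V → ι} {t : W → ι} {q : ℕ}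
    (ht : IsBalancedColoring t q) (hcard : Fintype.card V = Fintype.card W) {s : ℝ} (hs : 0 < s)
    (heq : ∑ v, 1 / (s + colorClassCard c (c v)) = ∑ w, 1 / (s + colorClassCard t (t w))) :
    IsBalancedColoring c q := by
  rw [sum_inv_add_colorClassCard, sum_inv_add_colorClassCard,
    sum_congr rfl fun j _ => (div_add_eq_chord_iff hs (colorClassCard t j) q).mpr (ht j),
    sum_chord_colorClassCard, ← hcard, ← sum_chord_colorClassCard,
    sum_eq_sum_iff_of_le fun j _ => div_add_le_chord hs _ _] at heq
  exact fun j => (div_add_eq_chord_iff hs _ _).mp (heq j (mem_univ j))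

theorem IsBalancedColoring.card_eq {c : V → ι} {q : ℕ} (hc : IsBalancedColoring c q) :
    Fintype.card V = Fintype.card ι * q + #{j | colorClassCard c j = q + 1} := by
  rw [← sum_colorClassCard c, card_filter, ← smul_eq_mul, ← card_univ, ← sum_const,
    ← sum_add_distrib]
  refine sum_congr rfl fun j _ => ?_
  rcases hc j with h | h <;> simp [h]

/-- Two balanced colourings of sets of the same size agree up to relabelling vertices and
colours. -/
theorem IsBalancedColoring.exists_equiv {W : Type*} [Fintype W] {c : V → ι} {t : W → ι} {q : ℕ}
    (hc : IsBalancedColoring c q) (ht : IsBalancedColoring t q)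
    (hcard : Fintype.card V = Fintype.card W) :
    ∃ (e : V ≃ W) (σ : Equiv.Perm ι), ∀ v, t (e v) = σ (c v) := by
  -- The number of large classes is forced: it is the number of vertices minus `q` times the number
  -- of colours.
  have hsub : Fintype.card {j // colorClassCard c j = q + 1} =
      Fintype.card {j // colorClassCard t j = q + 1} := by
    rw [Fintype.card_subtype, Fintype.card_subtype]
    have := hc.card_eq
    have := ht.card_eq
    lia
  let f := Fintype.equivOfCardEq hsub
  let σ : Equiv.Perm ι := f.extendSubtype
  have hσ : ∀ j, colorClassCard c j = colorClassCard t (σ j) := by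
    intro j
    by_cases hj : colorClassCard c j = q + 1
    · exact hj.trans (f.extendSubtype_mem j hj).symm
    · have h1 := f.extendSubtype_not_mem j hj
      exact ((hc j).resolve_right hj).trans ((ht (σ j)).resolve_right h1).symm
  have hfib : ∀ j, Nonempty ({v // c v = j} ≃ {w // t w = σ j}) := fun j => by
    rw [← Fintype.card_eq, Fintype.card_subtype, Fintype.card_subtype]
    exact hσ j
  let g := fun j => (hfib j).some
  refine ⟨(Equiv.sigmaFiberEquiv c).symm.trans
    ((Equiv.sigmaCongr σ g).trans (Equiv.sigmaFiberEquiv t)), σ, fun v => ?_⟩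
  exact (g (c v) ⟨v, rfl⟩).2

end ColorClass

/-! ### Entries of `RDα` and invariance under isomorphism. -/

namespace SimpleGraph

variable {V : Type*} [DecidableEq V]

theorem RDα_mulVec_apply [Fintype V] (G : SimpleGraph V) (α : ℝ) (y : V → ℝ) (u : V) :
    (G.RDα α *ᵥ y) u = ∑ v, G.recipDistMatrix u v * (α * y u + (1 - α) * y v) := by
  have h : G.recipTransmission u = ∑ v, G.recipDistMatrix u v := by
    rw [recipTransmission, ← add_sum_erase univ _ (mem_univ u)]
    simp only [recipDistMatrix, of_apply, if_true, zero_add]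
    exact sum_congr rfl fun v hv => by rw [if_neg (ne_of_mem_erase hv).symm]
  rw [RDα, add_mulVec, smul_mulVec, smul_mulVec]
  simp only [Pi.add_apply, Pi.smul_apply, mulVec_diagonal, smul_eq_mul, h]
  simp only [mulVec, dotProduct, sum_mul, mul_sum, ← sum_add_distrib]
  exact sum_congr rfl fun v _ => by ring

theorem recipDistMatrix_nonneg (G : SimpleGraph V) (u v : V) : 0 ≤ G.recipDistMatrix u v := by
  rw [recipDistMatrix, of_apply]
  split_ifs <;> positivity

theorem Connected.recipDistMatrix_pos {G : SimpleGraph V} (hG : G.Connected) {u v : V}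
    (h : u ≠ v) : 0 < G.recipDistMatrix u v := by
  have : (0 : ℝ) < G.dist u v := by exact_mod_cast hG.pos_dist_of_ne h
  rw [recipDistMatrix, of_apply, if_neg h]
  positivity

theorem RDα_nonneg [Fintype V] (G : SimpleGraph V) {α : ℝ} (h0 : 0 ≤ α) (h1 : α < 1) (u v : V) :
    0 ≤ G.RDα α u v := by
  have := G.recipDistMatrix_nonneg u v
  have : 0 ≤ (1 - α) := by linarith
  have : 0 ≤ diagonal G.recipTransmission u v := by
    rw [diagonal_apply]
    split_ifs
    · exact sum_nonneg fun _ _ => by positivity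
    · rfl
  simp only [RDα, Matrix.add_apply, Matrix.smul_apply, smul_eq_mul]
  positivity

theorem Connected.RDα_pos [Fintype V] {G : SimpleGraph V} (hG : G.Connected) {α : ℝ}
    (h1 : α < 1) {u v : V} (h : u ≠ v) : 0 < G.RDα α u v := by
  have := hG.recipDistMatrix_pos h
  have : 0 < (1 - α) := by linarith
  simp only [RDα, Matrix.add_apply, Matrix.smul_apply, smul_eq_mul, diagonal_apply_ne _ h,
    mul_zero, zero_add]
  positivity

theorem Iso.dist_eq {V W : Type*} {G : SimpleGraph V} {H : SimpleGraph W} (e : G ≃g H) (u v : V) :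
    H.dist (e u) (e v) = G.dist u v := by
  by_cases h : G.Reachable u v
  · obtain ⟨q, hq⟩ := h.exists_walk_length_eq_dist
    refine le_antisymm ((dist_le (q.map e.toHom)).trans (by rw [Walk.length_map, hq])) ?_
    obtain ⟨p, hp⟩ := (h.map e.toHom).exists_walk_length_eq_dist
    have := dist_le (p.map e.symm.toHom)
    simp only [Walk.length_map, hp] at this
    simpa using this
  · rw [dist_eq_zero_of_not_reachable h, dist_eq_zero_of_not_reachable (mt e.reachable_iff.mp h)]

theorem Iso.rhoRDα_eq [Fintype V] {W : Type*} [Fintype W] [DecidableEq W]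
    {G : SimpleGraph V} {H : SimpleGraph W} (e : G ≃g H) (α : ℝ) : G.rhoRDα α = H.rhoRDα α := by
  have h : reindexAlgEquiv ℝ ℝ e.toEquiv (G.RDα α) = H.RDα α := by
    ext u v
    have hd : ∀ u v, G.dist (e.symm u) (e.symm v) = H.dist u v := fun u v => by
      rw [← e.dist_eq]; simp
    have hr : G.recipTransmission (e.symm u) = H.recipTransmission u := by
      rw [recipTransmission, recipTransmission]
      refine sum_equiv e.toEquiv (fun v => ?_) fun v _ => ?_
      · simp only [mem_erase, mem_univ, and_true, ne_eq]
        exact not_congr e.toEquiv.eq_symm_apply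
      · rw [← hd]; simp
    have hq : e.symm u = e.symm v ↔ u = v := e.symm.injective.eq_iff
    have : (G.RDα α) (e.symm u) (e.symm v) = H.RDα α u v := by
      simp only [RDα, Matrix.add_apply, Matrix.smul_apply, diagonal_apply, recipDistMatrix,
        of_apply, hq, hr, hd]
    exact this
  rw [rhoRDα, rhoRDα, ← h, AlgEquiv.spectrum_eq]

/-! ### The complete multipartite model. -/

section Multipartite

variable {ι : Type*} [DecidableEq ι]

/-- The reciprocal distances in the complete multipartite graph with parts the fibres of `c`. -/
noncomputable def multipartiteRecipDist (c : V → ι) (u v : V) : ℝ :=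
  if u = v then 0 else if c u = c v then 1 / 2 else 1

theorem Connected.recipDistMatrix_le {G : SimpleGraph V} (hG : G.Connected) (c : G.Coloring ι)
    (u v : V) : G.recipDistMatrix u v ≤ multipartiteRecipDist c u v := by
  rw [recipDistMatrix, of_apply, multipartiteRecipDist]
  split_ifs with h hc
  · rfl
  · have : 2 ≤ G.dist u v :=
      hG.one_lt_dist_of_ne_of_not_adj h fun hadj => c.valid hadj hc
    exact one_div_le_one_div_of_le (by norm_num) (by exact_mod_cast this)
  · have : 1 ≤ G.dist u v := hG.pos_dist_of_ne h
    exact (one_div_le_one_div_of_le one_pos (by exact_mod_cast this)).trans (by norm_num)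

theorem adj_of_recipDistMatrix_eq {G : SimpleGraph V} (c : V → ι) {u v : V}
    (h : G.recipDistMatrix u v = multipartiteRecipDist c u v) (hc : c u ≠ c v) : G.Adj u v := by
  have hne : u ≠ v := fun h => hc (h ▸ rfl)
  rw [recipDistMatrix, of_apply, multipartiteRecipDist, if_neg hne, if_neg hne, if_neg hc,
    one_div, inv_eq_one] at h
  exact dist_eq_one_iff_adj.mp (by exact_mod_cast h)

theorem recipDistMatrix_eq_multipartiteRecipDist {G : SimpleGraph V} (hG : G.Connected)
    {c : V → ι} (hadj : ∀ u v, G.Adj u v ↔ c u ≠ c v) (hc : ∀ u, ∃ w, c w ≠ c u) (u v : V) :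
    G.recipDistMatrix u v = multipartiteRecipDist c u v := by
  rw [recipDistMatrix, of_apply, multipartiteRecipDist]
  split_ifs with h h'
  · rfl
  · obtain ⟨w, hw⟩ := hc u
    have h2 : G.dist u v ≤ 2 := dist_le
      (Walk.cons ((hadj u w).mpr hw.symm) (Walk.cons ((hadj w v).mpr (h' ▸ hw)) Walk.nil))
    have h1 : 2 ≤ G.dist u v :=
      hG.one_lt_dist_of_ne_of_not_adj h fun hh => (hadj u v).mp hh h'
    rw [le_antisymm h2 h1]
    norm_num
  · rw [dist_eq_one_iff_adj.mpr ((hadj u v).mpr h')]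
    norm_num

/-- The model is the all-ones matrix corrected by 1/2 within classes and 1/2 more on the diagonal.
The class correction `size * y u / 2` equals `(1 - s * y u) / 2`, so class sizes drop out of the
coefficient of `y u`. -/
theorem sum_multipartiteRecipDist [Fintype V] (c : V → ι) (α s : ℝ) {y : V → ℝ} (hy : ∀ v, y v = 1 / (s + colorClassCard c (c v))) (hs : 0 < s) (u : V) :
    ∑ v, multipartiteRecipDist c u v * (α * y u + (1 - α) * y v) =
      (α * Fintype.card V + (s - 1) / 2) * y u + ((1 - α) * ∑ v, y v - 1 / 2) := by
  have hterm : ∀ v, multipartiteRecipDist c u v * (α * y u + (1 - α) * y v) =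
      α * y u + (1 - α) * y v - (if c v = c u then y u / 2 else 0) -
        (if v = u then y u / 2 else 0) := by
    intro v
    rw [multipartiteRecipDist]
    by_cases h : v = u
    · subst h; simp; ring
    · by_cases h' : c v = c u
      · have : y v = y u := by rw [hy, hy, h']
        rw [if_neg (Ne.symm h), if_pos h'.symm, if_pos h', if_neg h, this]; ring
      · rw [if_neg (Ne.symm h), if_neg (Ne.symm h'), if_neg h', if_neg h]; ring
  have hyu : (s + colorClassCard c (c u)) * y u = 1 := by
    rw [hy]; field_simp
  have hcls : ∑ v, (if c v = c u then y u / 2 else 0) = colorClassCard c (c u) * (y u / 2) := by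
    rw [← sum_filter, sum_const, nsmul_eq_mul]; rfl
  simp only [hterm, sum_sub_distrib, sum_add_distrib, hcls, ← mul_sum, sum_const, card_univ,
    nsmul_eq_mul, sum_ite_eq', mem_univ, if_true]
  linear_combination (-1 / 2 : ℝ) * hyu

end Multipartite

/-! ### The Turán graph and its spectral radius. -/

/-- The colouring of the Turán graph by residues. -/
def turanColor {n χ : ℕ} (hχ : 0 < χ) (v : Fin n) : Fin χ := ⟨v % χ, Nat.mod_lt _ hχ⟩

theorem turanGraph_adj_iff_turanColor_ne {n χ : ℕ} (hχ : 0 < χ) (u v : Fin n) :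
    (turanGraph n χ).Adj u v ↔ turanColor hχ u ≠ turanColor hχ v := by
  simp [turanGraph_adj, turanColor]

theorem isBalancedColoring_turanColor {n χ : ℕ} (hχ : 0 < χ) :
    IsBalancedColoring (turanColor (n := n) hχ) (n / χ) := by
  intro j
  have h : colorClassCard (turanColor (n := n) hχ) j = n.count (· ≡ j [MOD χ]) := by
    rw [Nat.count_eq_card_filter_range, card_filter, colorClassCard, card_filter,
      ← Fin.sum_univ_eq_sum_range (fun i => if i ≡ j [MOD χ] then 1 else 0)]
    refine sum_congr rfl fun v _ => ?_
    simp [turanColor, Fin.ext_iff, Nat.ModEq, Nat.mod_eq_of_lt j.2]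
  rw [h, Nat.count_modEq_card _ hχ]
  split_ifs <;> simp

theorem exists_turanColor_ne {n χ : ℕ} (hn : 2 ≤ n) (hχ : 2 ≤ χ) (u : Fin n) :
    ∃ w : Fin n, turanColor (by lia : 0 < χ) w ≠ turanColor (by lia : 0 < χ) u := by
  by_cases h : (u : ℕ) % χ = 0
  · exact ⟨⟨1, by lia⟩, by simp [turanColor, h, Nat.mod_eq_of_lt hχ]⟩
  · exact ⟨⟨0, by lia⟩, by simpa [turanColor] using Ne.symm h⟩

theorem turanGraph_connected {n χ : ℕ} (hn : 2 ≤ n) (hχ : 2 ≤ χ) :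
    (turanGraph n χ).Connected := by
  have : Nonempty (Fin n) := ⟨⟨0, by lia⟩⟩
  refine ⟨fun u v => ?_⟩
  have hadj := turanGraph_adj_iff_turanColor_ne (n := n) (by lia : 0 < χ)
  by_cases h : turanColor (by lia : 0 < χ) u = turanColor (by lia : 0 < χ) v
  · obtain ⟨w, hw⟩ := exists_turanColor_ne hn hχ u
    exact ((hadj u w).mpr hw.symm).reachable.trans ((hadj w v).mpr (h ▸ hw)).reachable
  · exact ((hadj u v).mpr h).reachable

theorem chromaticNumber_turanGraph {n χ : ℕ} (hχ : 0 < χ) (hχn : χ ≤ n) :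
    (turanGraph n χ).chromaticNumber = χ := by
  refine le_antisymm (Colorable.chromaticNumber_le ⟨Coloring.mk (turanColor hχ)
    fun {u v} h => (turanGraph_adj_iff_turanColor_ne hχ u v).mp h⟩) ?_
  -- For the lower bound, a Turán-maximal graph on at least `χ` vertices contains a `χ`-clique.
  have h := not_cliqueFree_of_isTuranMaximal (by simpa using hχn)
    (isTuranMaximal_turanGraph (n := n) hχ)
  simp only [CliqueFree, not_forall, not_not] at h
  obtain ⟨s, hs⟩ := h
  exact hs.card_eq ▸ hs.isClique.card_le_chromaticNumber

end SimpleGraph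

open SimpleGraph in
theorem rhoRDα_turanGraph_eq {n χ : ℕ} (hn : 2 ≤ n) (hχ : 2 ≤ χ) {α s : ℝ} (hα₀ : 0 ≤ α)
    (hα₁ : α < 1) (hs : 0 < s)
    (hsum : (1 - α) * ∑ v : Fin n, 1 / (s + colorClassCard
      (turanColor (n := n) (zero_lt_two.trans_le hχ)) (turanColor (zero_lt_two.trans_le hχ) v)) =
        1 / 2) :
    (turanGraph n χ).rhoRDα α = α * n + (s - 1) / 2 := by
  have : Nonempty (Fin n) := ⟨⟨0, by lia⟩⟩
  let t : Fin n → Fin χ := turanColor (zero_lt_two.trans_le hχ)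
  let y : Fin n → ℝ := fun v => 1 / (s + colorClassCard t (t v))
  have hy : ∀ v, 0 < y v := fun v => by positivity
  have hmul : ∀ u, ((turanGraph n χ).RDα α *ᵥ y) u = (α * n + (s - 1) / 2) * y u := by
    intro u
    rw [RDα_mulVec_apply, sum_congr rfl fun v _ => by
      rw [recipDistMatrix_eq_multipartiteRecipDist (turanGraph_connected hn hχ)
        (turanGraph_adj_iff_turanColor_ne (by lia)) (exists_turanColor_ne hn hχ) u v],
      sum_multipartiteRecipDist t α s (fun _ => rfl) hs, hsum, Fintype.card_fin]
    ring
  refine le_antisymm ?_ ?_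
  · exact le_of_mem_spectrum_of_mulVec_le (RDα_nonneg _ hα₀ hα₁) hy (fun u => (hmul u).le)
      (isGreatest_rhoRDα _ α).1
  · refine (isGreatest_rhoRDα _ α).2 (mem_spectrum_iff_exists_mulVec_eq_smul.mpr ⟨y, ?_, ?_⟩)
    · exact Function.ne_iff.mpr ⟨Classical.arbitrary _, (hy _).ne'⟩
    · ext u
      exact hmul u

theorem theorem4p4 (n χ : ℕ) (hn : 2 ≤ n) (hχ : 2 ≤ χ) (hχn : χ ≤ n)
    (α : ℝ) (hα₀ : 0 ≤ α) (hα₁ : α ≤ 7 / 16) :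
    ((SimpleGraph.turanGraph n χ).Connected ∧
      (SimpleGraph.turanGraph n χ).chromaticNumber = (χ : ℕ∞)) ∧
    ∀ {V : Type*} [Fintype V] [DecidableEq V] (G : SimpleGraph V),
      Fintype.card V = n → G.Connected → G.chromaticNumber = (χ : ℕ∞) →
        G.rhoRDα α ≤ (SimpleGraph.turanGraph n χ).rhoRDα α ∧
        (G.rhoRDα α = (SimpleGraph.turanGraph n χ).rhoRDα α ↔
          Nonempty (G ≃g SimpleGraph.turanGraph n χ)) := by
  open SimpleGraph in
  have hχ0 : 0 < χ := by lia
  refine ⟨⟨turanGraph_connected hn hχ, chromaticNumber_turanGraph hχ0 hχn⟩, ?_⟩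
  intro V _ _ G hV hG hGχ
  have : Nonempty (Fin n) := ⟨⟨0, by lia⟩⟩
  have := hG.nonempty
  have hα : 0 < 1 - α := by linarith
  let t : Fin n → Fin χ := turanColor hχ0
  -- The target `1 / (2 * (1 - α))` lies in `[1/2, 1)` exactly when `0 ≤ α < 1/2`.
  obtain ⟨s, hs, hsum⟩ := exists_pos_sum_inv_add_colorClassCard_eq t
    (b := 1 / (2 * (1 - α))) (one_div_le_one_div_of_le (by linarith) (by linarith))
    ((div_lt_one (by linarith)).mpr (by linarith))
  have hsum' : (1 - α) * ∑ v, 1 / (s + colorClassCard t (t v)) = 1 / 2 := by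
    rw [hsum]; field_simp
  rw [rhoRDα_turanGraph_eq hn hχ hα₀ (by linarith) hs hsum']
  obtain ⟨c⟩ := chromaticNumber_le_iff_colorable.mp hGχ.le
  let y : V → ℝ := fun v => 1 / (s + colorClassCard c (c v))
  have hy : ∀ v, 0 < y v := fun v => by positivity
  have hcoef : ∀ u v, 0 < α * y u + (1 - α) * y v := fun u v =>
    add_pos_of_nonneg_of_pos (mul_nonneg hα₀ (hy u).le) (mul_pos hα (hy v))
  have hbal : IsBalancedColoring t (n / χ) := isBalancedColoring_turanColor hχ0
  have hcard : Fintype.card V = Fintype.card (Fin n) := by rw [hV, Fintype.card_fin]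
  have hSle : (1 - α) * ∑ v, y v ≤ 1 / 2 := by
    rw [← hsum']
    exact mul_le_mul_of_nonneg_left (sum_inv_add_colorClassCard_le hbal hcard hs) hα.le
  have hterm : ∀ u v, G.recipDistMatrix u v * (α * y u + (1 - α) * y v) ≤
      multipartiteRecipDist c u v * (α * y u + (1 - α) * y v) := fun u v =>
    mul_le_mul_of_nonneg_right (hG.recipDistMatrix_le c u v) (hcoef u v).le
  have hmodel := sum_multipartiteRecipDist c α s (y := y) (fun _ => rfl) hs
  rw [hV] at hmodel
  have hmul : ∀ u, (G.RDα α *ᵥ y) u ≤ (α * n + (s - 1) / 2) * y u := fun u => by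
    rw [RDα_mulVec_apply]
    have h1 := sum_le_sum fun v (_ : v ∈ univ) => hterm u v
    rw [hmodel] at h1
    linarith
  have hspec := (isGreatest_rhoRDα G α).1
  have hnn := RDα_nonneg G hα₀ (by linarith : α < 1)
  refine ⟨le_of_mem_spectrum_of_mulVec_le hnn hy hmul hspec, fun heq => ?_, fun ⟨e⟩ => ?_⟩
  · rw [heq] at hspec
    have heig := mulVec_eq_of_mem_spectrum hnn (fun u v h => hG.RDα_pos (by linarith) h) hy hmul
      hspec
    simp only [RDα_mulVec_apply] at heig
    -- At any vertex, the eigenvalue equation and the model bound give `(1 - α) * ∑ y ≥ 1 / 2`, the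
    -- reverse of `hSle`.
    have hS : ∑ v, y v = ∑ v, 1 / (s + colorClassCard t (t v)) := by
      obtain ⟨u⟩ := hG.nonempty
      have h1 := sum_le_sum fun v (_ : v ∈ univ) => hterm u v
      rw [hmodel, heig] at h1
      exact mul_left_cancel₀ hα.ne' (by linarith)
    have hdist : ∀ u v, G.recipDistMatrix u v = multipartiteRecipDist c u v := by
      intro u v
      have h1 : ∑ v, G.recipDistMatrix u v * (α * y u + (1 - α) * y v) =
          ∑ v, multipartiteRecipDist c u v * (α * y u + (1 - α) * y v) := by
        rw [heig, hmodel, hS, hsum']; ring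
      exact mul_right_cancel₀ (hcoef u v).ne'
        ((sum_eq_sum_iff_of_le fun v _ => hterm u v).mp h1 v (mem_univ v))
    obtain ⟨e, σ, he⟩ :=
      (isBalancedColoring_of_sum_eq hbal hcard hs hS).exists_equiv hbal hcard
    refine ⟨⟨e, fun {u v} => ?_⟩⟩
    rw [turanGraph_adj_iff_turanColor_ne hχ0]
    change t (e u) ≠ t (e v) ↔ _
    rw [he, he, σ.injective.ne_iff]
    exact ⟨adj_of_recipDistMatrix_eq c (hdist u v), fun h => c.valid h⟩
  · rw [e.rhoRDα_eq, rhoRDα_turanGraph_eq hn hχ hα₀ (by linarith) hs hsum']
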